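/- Let $A$ be a commutative ring (with identity) that is arithmetical, i.e. whose lattice of ideals is distributive: $I\cap(J+K)=(I\cap J)+(I\cap K)$ for all ideals $I,J,K$ of $A$. For an $A$-module $M$ the Krull dimension $\operatorname{Kdim} M$ in the sense of Gabriel and Rentschler is defined (if it exists) by transfinite recursion: $\operatorname{Kdim} M=-1$ if and only if $M=0$; and for an ordinal $\alpha\ge 0$, $\operatorname{Kdim} M=\alpha$ if $\operatorname{Kdim} M\neq\beta$ for every $\beta<\alpha$ (including $\beta=-1$) and for every infinite strictly descending chain $M_1>M_2>\cdots$ of submodules of $M$ there is a positive integer $n$ such that $\operatorname{Kdim}(M_n/M_{n+1})$ exists and is less than $\alpha$. (Thus $\operatorname{Kdim}M=0$ means that $M$ is a non-zero Artinian module.) The ring $A$ has Krull dimension if $\operatorname{Kdim} A$ exists for $A$ regarded as a module over itself. A ring is finite-dimensional if it does not contain a direct sum of infinitely many non-zero ideals. An ideal $B$ of a commutative ring $R$ is idempotent if $B=B^2$, proper if $B\ne R$, and essential if $B\cap Y\neq 0$ for every non-zero ideal $Y$ of $R$. Then the following conditions are equivalent: 1. $A$ has Krull dimension. 2. Every factor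 ring of $A$ is finite-dimensional and has no idempotent proper essential ideals. -/

import Mathlib

universe u v

/-- A commutative ring is *arithmetical* if its lattice of ideals is distributive. -/
def IsArithmeticalRing (A : Type u) [CommRing A] : Prop :=
  ∀ I J K : Ideal A, I ⊓ (J ⊔ K) = (I ⊓ J) ⊔ (I ⊓ K)

/-- `IsKrullDim R α M`: the Krull dimension (in the sense of Gabriel and Rentschler) of the
`R`-module `M` exists and equals `α`, where `α` is `-1` (written `⊥`) or an ordinal.

* `M` has Krull dimension `-1` iff `M` is zero.
* `M` has Krull dimension the ordinal `α` iff it does not have Krull dimension `β` for any `β < α`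
  (in particular `M` is non-zero), and every infinite strictly descending chain
  `M₀ > M₁ > ⋯` of submodules has a factor `Mₙ / Mₙ₊₁` of Krull dimension `< α`.

For `α = 0` the condition on chains says that there are none (the factors of a strictly
descending chain are non-zero), i.e. that `M` is a non-zero Artinian module. -/
def IsKrullDim (R : Type u) [Ring R] (α : WithBot Ordinal.{v})
    (M : Type v) [AddCommGroup M] [Module R M] : Prop :=
  (α = ⊥ ∧ Subsingleton M) ∨
  (α ≠ ⊥ ∧ (∀ β : WithBot Ordinal.{v}, ∀ _hβ : β < α, ¬ IsKrullDim R β M) ∧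
    ∀ f : ℕ → Submodule R M, StrictAnti f →
      ∃ n : ℕ, ∃ β : WithBot Ordinal.{v}, ∃ _hβ : β < α,
        IsKrullDim R β (f n ⧸ (f (n + 1)).submoduleOf (f n)))
termination_by (wellFounded_lt (α := WithBot Ordinal.{v})).wrap α
decreasing_by all_goals exact _hβ

/-- The module `M` has Krull dimension (in the sense of Gabriel and Rentschler). -/
def HasKrullDim (R : Type u) [Ring R] (M : Type v) [AddCommGroup M] [Module R M] : Prop :=
  ∃ α : WithBot Ordinal.{v}, IsKrullDim R α M

/-- A module is *finite-dimensional* (has finite uniform dimension) if it does not contain a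
direct sum of infinitely many non-zero submodules. -/
def IsFiniteDimensionalModule (R : Type u) [Ring R] (M : Type v) [AddCommGroup M] [Module R M] :
    Prop :=
  ¬ ∃ f : ℕ → Submodule R M, (∀ i, f i ≠ ⊥) ∧ iSupIndep f

/-- A submodule is *essential* if it meets every non-zero submodule non-trivially. -/
def IsEssentialSubmodule {R : Type u} [Ring R] {M : Type v} [AddCommGroup M] [Module R M]
    (X : Submodule R M) : Prop :=
  ∀ Y : Submodule R M, Y ≠ ⊥ → X ⊓ Y ≠ ⊥

/-!
By Lemonnier's criterion (`hasKrullDim_iff`), a module has Krull dimension if and only if its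
lattice of submodules contains no dense chain (`DenseBetween`). The theorem is proved in this form.
The other basic tool is that a commutative ring is arithmetical only if the principal ideals of its
localizations at primes form chains (`IsArithmeticalRing.locallyComparable`); localizations are
handled inside the ring through saturations of ideals (`saturation`).

*Krull dimension implies the conditions on factor rings.* An infinite direct sum produces a dense
chain of partial sums. Let `B` be an idempotent ideal of a factor ring. If some `b ∈ B` does not
vanish in the localization at a maximal ideal `m ≥ B`, then the local ideals `(c d) < (c)` with
`d ∈ B` form a dense chain, because locally `d = d₁ d₂` with `d₁, d₂ ∈ B`
(`exists_denseBetween_of_idempotent`). So `B` vanishes locally at all such `m`, that is, `B` is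
pure; and a pure essential ideal of a finite-dimensional ring is the whole ring
(`eq_top_of_pure_of_isEssentialSubmodule`).

*The conditions on factor rings imply Krull dimension.* Idempotent ideals of factor rings are direct
summands (`exists_compl_of_idempotent`). Hence the prime ideals satisfy the ascending chain
condition, as the union of a strictly ascending chain of primes is idempotent. Since `A / √J` is
finite-dimensional, `J` has finitely many minimal primes. For such a prime `P`, the maximal ideal of
the localization of `A / J` at `P` consists of nilpotent elements and is zero or not idempotent, so
it is nilpotent; it follows that some power of `P` vanishes in the localizations of `A / J` at all
primes above `P`. Therefore `J` contains a product of powers of its minimal primes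
(`LocallyComparable.exists_prod_pow_le`). Finally, when all factor rings are finite-dimensional, a
module `Q / K` with ideals `K ≤ Q` has Krull dimension as soon as its cyclic submodules do
(`not_denseBetween_of_forall_mem`), so the ideals `P` for which `A / P` has Krull dimension are
closed under products. Let `P` be maximal among the primes for which `A / P` has no Krull dimension.
The midpoint of a dense chain from `P` to `A` is an ideal strictly above `P` whose factor ring has
no Krull dimension, but this ideal contains a product of primes strictly above `P`, a contradiction.
So no such `P` exists, and `A` has Krull dimension because its zero ideal is a product of primes.
-/

/-! ### Dense intervals in partially ordered sets -/

/-- A relation on a partially ordered set is dense if it implies `<` and any two related elements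
have an element between them that is related to both. -/
def IsDenseRel {L : Type*} [PartialOrder L] (W : L → L → Prop) : Prop :=
  ∀ a b, W a b → a < b ∧ ∃ c, W a c ∧ W c b

/-- `a < b` and the interval `[a, b]` contains a densely ordered chain from `a` to `b`. The chain is
encoded by a dense relation relating `a` to `b`: iterating the choice of intermediate elements
produces a copy of the dyadic rationals. -/
def DenseBetween {L : Type*} [PartialOrder L] (a b : L) : Prop :=
  ∃ W : L → L → Prop, IsDenseRel W ∧ W a b

namespace DenseBetween

section PartialOrder

variable {L L' : Type*} [PartialOrder L] [PartialOrder L'] {a b c d : L}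

theorem lt (h : DenseBetween a b) : a < b :=
  let ⟨_, hW, hab⟩ := h
  (hW a b hab).1

theorem exists_between (h : DenseBetween a b) : ∃ c, DenseBetween a c ∧ DenseBetween c b :=
  let ⟨W, hW, hab⟩ := h
  let ⟨_, c, hac, hcb⟩ := hW a b hab
  ⟨c, ⟨W, hW, hac⟩, ⟨W, hW, hcb⟩⟩

theorem mono (h : DenseBetween a b) (hca : c ≤ a) (hbd : b ≤ d) : DenseBetween c d := by
  refine ⟨fun x y => ∃ x' y', x ≤ x' ∧ y' ≤ y ∧ DenseBetween x' y', ?_, a, b, hca, hbd, h⟩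
  rintro x y ⟨x', y', hx, hy, h'⟩
  obtain ⟨z, h₁, h₂⟩ := h'.exists_between
  exact ⟨hx.trans_lt (h'.lt.trans_le hy), z, ⟨x', z, hx, le_rfl, h₁⟩, ⟨z, y', le_rfl, hy, h₂⟩⟩

/-- A map that strictly preserves the order on all pairs of the interval `[a, b]` that are
themselves connected by a dense chain carries dense chains to dense chains. -/
theorem map {φ : L → L'} (h : DenseBetween a b)
    (hφ : ∀ x y, a ≤ x → y ≤ b → DenseBetween x y → φ x < φ y) : DenseBetween (φ a) (φ b) := by
  refine ⟨fun u v => ∃ x y, a ≤ x ∧ y ≤ b ∧ DenseBetween x y ∧ φ x = u ∧ φ y = v, ?_,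
    a, b, le_rfl, le_rfl, h, rfl, rfl⟩
  rintro _ _ ⟨x, y, hx, hy, h', rfl, rfl⟩
  obtain ⟨z, h₁, h₂⟩ := h'.exists_between
  exact ⟨hφ x y hx hy h', φ z, ⟨x, z, hx, h₂.lt.le.trans hy, h₁, rfl, rfl⟩,
    ⟨z, y, hx.trans h₁.lt.le, hy, h₂, rfl, rfl⟩⟩

theorem of_isDenseRel {W : L → L → Prop} (hW : IsDenseRel W) (h : W a b) : DenseBetween a b :=
  ⟨W, hW, h⟩

end PartialOrder

section Lattice

variable {L : Type*} [Lattice L] {a b c : L}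

/-- If intersecting with `c` destroys a dense chain, it does so by collapsing a whole dense
subinterval to a point. -/
theorem exists_inf_eq (h : DenseBetween a b) (hc : ¬ DenseBetween (a ⊓ c) (b ⊓ c)) :
    ∃ x y, a ≤ x ∧ y ≤ b ∧ DenseBetween x y ∧ x ⊓ c = y ⊓ c := by
  by_contra! H
  exact hc (h.map (φ := (· ⊓ c)) fun x y hx hy h' =>
    lt_of_le_of_ne (inf_le_inf_right c h'.lt.le) (H x y hx hy h'))

/-- In a modular lattice, the intervals without dense chains can be composed. -/
theorem trans_not [IsModularLattice L] (hab : a ≤ b) (hbc : b ≤ c)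
    (h₁ : ¬ DenseBetween a b) (h₂ : ¬ DenseBetween b c) : ¬ DenseBetween a c := by
  intro h
  obtain ⟨x, y, hx, hy, h', he⟩ := h.exists_inf_eq (c := b)
    (by rwa [inf_eq_left.2 hab, inf_eq_right.2 hbc])
  refine h₂ ((h'.map (φ := (· ⊔ b)) fun s t hs ht hst => ?_).mono le_sup_right
    (sup_le hy hbc))
  refine lt_of_le_of_ne (sup_le_sup_right hst.lt.le b) fun hsup => hst.lt.ne ?_
  refine eq_of_le_of_inf_le_of_sup_le hst.lt.le (z := b) ?_ hsup.ge
  exact (inf_le_inf_right b ht).trans (he.ge.trans (inf_le_inf_right b hs))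

end Lattice

end DenseBetween

/-! ### Krull dimension and dense chains of submodules -/

section KrullDim

variable {R : Type u} [Ring R]

/-- The submodule of `M` between `K` and `N` that corresponds to a submodule of `N / K`. -/
def subquotientLift {M : Type v} [AddCommGroup M] [Module R M] (K N : Submodule R M)
    (X : Submodule R (N ⧸ K.submoduleOf N)) : Submodule R M :=
  (X.comap (K.submoduleOf N).mkQ).map N.subtype

section subquotientLift

variable {M : Type v} [AddCommGroup M] [Module R M] (K N : Submodule R M)

theorem subquotientLift_strictMono : StrictMono (subquotientLift K N) :=
  (Submodule.map_strictMono_of_injective N.injective_subtype).comp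
    (Submodule.comap_strictMono_of_surjective (Submodule.mkQ_surjective _))

theorem subquotientLift_le (X : Submodule R (N ⧸ K.submoduleOf N)) : subquotientLift K N X ≤ N :=
  Submodule.map_subtype_le _ _

theorem le_subquotientLift (h : K ≤ N) (X : Submodule R (N ⧸ K.submoduleOf N)) :
    K ≤ subquotientLift K N X := by
  intro x hx
  refine ⟨⟨x, h hx⟩, ?_, rfl⟩
  have : (K.submoduleOf N).mkQ ⟨x, h hx⟩ = 0 := (Submodule.Quotient.mk_eq_zero _).2 hx
  simp [this]

theorem exists_subquotientLift_eq {Y : Submodule R M} (hK : K ≤ Y) (hN : Y ≤ N) :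
    ∃ X, subquotientLift K N X = Y := by
  refine ⟨(Y.submoduleOf N).map (K.submoduleOf N).mkQ, ?_⟩
  have hle : K.submoduleOf N ≤ Y.submoduleOf N := Submodule.comap_mono hK
  rw [subquotientLift, Submodule.comap_map_mkQ, sup_eq_right.2 hle,
    Submodule.submoduleOf, Submodule.map_comap_subtype, inf_eq_right.2 hN]

end subquotientLift

/-- By induction on `α`: a dense chain contains a descending sequence, and one of its factors has
smaller Krull dimension but again contains a dense chain. -/
theorem not_denseBetween_of_isKrullDim (α : WithBot Ordinal.{v}) :
    ∀ (M : Type v) [AddCommGroup M] [Module R M], IsKrullDim R α M →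
      ∀ a b : Submodule R M, ¬ DenseBetween a b := by
  induction α using WellFoundedLT.induction with
  | ind α ih =>
  intro M _ _ hα a b h
  rw [IsKrullDim] at hα
  obtain ⟨-, hM⟩ | ⟨-, -, hα⟩ := hα
  · exact h.lt.ne (Subsingleton.elim _ _)
  -- Repeated choice of intermediate elements above `a` gives a descending chain.
  let S := {x : Submodule R M // DenseBetween a x}
  have hstep : ∀ x : S, ∃ y : S, DenseBetween y.1 x.1 := fun x =>
    let ⟨c, h₁, h₂⟩ := x.2.exists_between
    ⟨⟨c, h₁⟩, h₂⟩
  choose g hg using hstep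
  let f : ℕ → S := fun n => g^[n] ⟨b, h⟩
  have hf : ∀ n, DenseBetween (f (n + 1)).1 (f n).1 := fun n => by
    simp only [f, Function.iterate_succ_apply']
    exact hg _
  obtain ⟨n, β, hβ, hK⟩ := hα (fun n => (f n).1) (strictAnti_nat_of_succ_lt fun n => (hf n).lt)
  set K := (f (n + 1)).1
  set N := (f n).1
  have hKN : K ≤ N := (hf n).lt.le
  obtain ⟨X, hX⟩ := exists_subquotientLift_eq K N le_rfl hKN
  obtain ⟨Y, hY⟩ := exists_subquotientLift_eq K N hKN le_rfl
  refine ih β hβ _ hK X Y (.of_isDenseRel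
    (W := fun X Y => DenseBetween (subquotientLift K N X) (subquotientLift K N Y)) ?_
    (by simpa only [hX, hY] using hf n))
  intro X Y hXY
  refine ⟨lt_of_le_of_ne ?_ ?_, ?_⟩
  · have hmono : ∀ X Y, subquotientLift K N X ≤ subquotientLift K N Y → X ≤ Y := by
      intro X Y hle
      rw [subquotientLift, subquotientLift,
        Submodule.map_le_map_iff_of_injective N.injective_subtype] at hle
      exact (Submodule.comap_le_comap_iff_of_surjective (Submodule.mkQ_surjective _)).1 hle
    exact hmono X Y hXY.lt.le
  · rintro rfl
    exact hXY.lt.ne rfl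
  · obtain ⟨c, h₁, h₂⟩ := hXY.exists_between
    obtain ⟨Z, rfl⟩ := exists_subquotientLift_eq K N
      ((le_subquotientLift K N hKN X).trans h₁.lt.le) (h₂.lt.le.trans (subquotientLift_le K N Y))
    exact ⟨Z, h₁, h₂⟩

/-- The Krull dimension exists once every strictly descending chain has a factor whose Krull
dimension exists: since the submodules form a set, these dimensions have a common upper bound. -/
theorem hasKrullDim_of_chain {M : Type v} [AddCommGroup M] [Module R M]
    (h : ∀ f : ℕ → Submodule R M, StrictAnti f →
      ∃ n, HasKrullDim R (f n ⧸ (f (n + 1)).submoduleOf (f n))) : HasKrullDim R M := by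
  classical
  let d : Submodule R M × Submodule R M → Ordinal.{v} := fun p =>
    if hp : HasKrullDim R (p.1 ⧸ p.2.submoduleOf p.1) then (Classical.choose hp).unbotD 0 else 0
  obtain ⟨o, ho⟩ := (Ordinal.bddAbove_of_small (s := Set.range d))
  by_contra hM
  refine hM ⟨((Order.succ o : Ordinal.{v}) : WithBot Ordinal.{v}), ?_⟩
  rw [IsKrullDim]
  refine Or.inr ⟨WithBot.coe_ne_bot, fun β _ hβ => hM ⟨β, hβ⟩, fun f hf => ?_⟩
  obtain ⟨n, hn⟩ := h f hf
  refine ⟨n, Classical.choose hn, ?_, Classical.choose_spec hn⟩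
  have hd : d (f n, f (n + 1)) ≤ o := ho ⟨_, rfl⟩
  simp only [d, dif_pos hn] at hd
  generalize Classical.choose hn = γ at hd ⊢
  induction γ using WithBot.recBotCoe with
  | bot => exact WithBot.bot_lt_coe _
  | coe γ => exact WithBot.coe_lt_coe.2 (Order.lt_succ_of_le hd)

/-- Lemonnier's criterion: the Krull dimension of a module exists if and only if the module has no
densely ordered chain of submodules. -/
theorem hasKrullDim_iff (M : Type v) [AddCommGroup M] [Module R M] :
    HasKrullDim R M ↔ ∀ a b : Submodule R M, ¬ DenseBetween a b := by
  refine ⟨fun ⟨α, hα⟩ => not_denseBetween_of_isKrullDim α M hα, fun h => ?_⟩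
  by_contra hM
  -- Intervals that contain the submodule lattice of a module without Krull dimension.
  refine h ⊥ ⊤ (.of_isDenseRel (W := fun a b => ∃ (N : Type v) (_ : AddCommGroup N) (_ : Module R N)
    (e : Submodule R N → Submodule R M), StrictMono e ∧ (∀ X, a ≤ e X ∧ e X ≤ b) ∧
      ¬ HasKrullDim R N) ?_ ⟨M, _, _, id, strictMono_id, fun _ => ⟨bot_le, le_top⟩, hM⟩)
  rintro a b ⟨N, _, _, e, he, hab, hN⟩
  have hex : ∃ f : ℕ → Submodule R N, StrictAnti f ∧
      ∀ n, ¬ HasKrullDim R (f n ⧸ (f (n + 1)).submoduleOf (f n)) := by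
    by_contra! H
    exact hN (hasKrullDim_of_chain H)
  obtain ⟨f, hf, hfd⟩ := hex
  have hlt : ∀ n, f (n + 1) < f n := fun n => hf n.lt_succ_self
  refine ⟨(hab _).1.trans_lt ((he (hlt 0)).trans_le (hab _).2), e (f 1),
    ⟨_, _, _, fun X => e (subquotientLift (f 2) (f 1) X),
      he.comp (subquotientLift_strictMono _ _), fun X => ⟨(hab _).1, ?_⟩, hfd 1⟩,
    ⟨_, _, _, fun X => e (subquotientLift (f 1) (f 0) X),
      he.comp (subquotientLift_strictMono _ _), fun X => ⟨?_, (hab _).2⟩, hfd 0⟩⟩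
  · exact he.monotone (subquotientLift_le _ _ X)
  · exact he.monotone (le_subquotientLift _ _ (hlt 0).le X)

end KrullDim

/-! ### Saturation of ideals and the local comparability of principal ideals -/

section Saturation

variable {R : Type*} [CommRing R]

/-- The `P`-saturation of an ideal `J` for a prime ideal `P`: the elements that lie in `J` after
localization at `P`, i.e. the preimage in `R` of the extension of `J` to `R_P`. -/
def saturation (P : Ideal R) [P.IsPrime] (J : Ideal R) : Ideal R where
  carrier := {x | ∃ s, s ∉ P ∧ s * x ∈ J}
  zero_mem' := ⟨1, P.one_notMem, by simp⟩
  add_mem' := by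
    rintro x y ⟨s, hs, hx⟩ ⟨t, ht, hy⟩
    refine ⟨s * t, fun h => (Ideal.IsPrime.mem_or_mem ‹_› h).elim hs ht, ?_⟩
    have : s * t * (x + y) = t * (s * x) + s * (t * y) := by ring
    rw [this]
    exact J.add_mem (J.mul_mem_left _ hx) (J.mul_mem_left _ hy)
  smul_mem' := by
    rintro r x ⟨s, hs, hx⟩
    refine ⟨s, hs, ?_⟩
    rw [smul_eq_mul, mul_left_comm]
    exact J.mul_mem_left _ hx

variable (P : Ideal R) [hP : P.IsPrime] {I J : Ideal R}

theorem le_saturation : J ≤ saturation P J := fun x hx => ⟨1, P.one_notMem, by simpa⟩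

theorem saturation_mono (h : I ≤ J) : saturation P I ≤ saturation P J :=
  fun _ ⟨s, hs, hx⟩ => ⟨s, hs, h hx⟩

theorem mem_saturation_of_mul_mem {s x : R} (hs : s ∉ P) (h : s * x ∈ saturation P J) :
    x ∈ saturation P J := by
  obtain ⟨t, ht, h⟩ := h
  exact ⟨t * s, fun h => (hP.mem_or_mem h).elim ht hs, by rwa [mul_assoc]⟩

theorem saturation_le_iff : saturation P I ≤ saturation P J ↔ I ≤ saturation P J :=
  ⟨(le_saturation P).trans, fun h _ ⟨_, hs, hx⟩ => mem_saturation_of_mul_mem P hs (h hx)⟩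

theorem saturation_span_mul {s x : R} (hs : s ∉ P) :
    saturation P (Ideal.span {s * x}) = saturation P (Ideal.span {x}) := by
  refine le_antisymm (saturation_mono P ?_) ?_
  · rw [Ideal.span_singleton_le_iff_mem]
    exact Ideal.mul_mem_left _ _ (Ideal.mem_span_singleton_self x)
  · rw [saturation_le_iff, Ideal.span_singleton_le_iff_mem]
    exact ⟨s, hs, Ideal.mem_span_singleton_self _⟩

theorem saturation_mul_le : saturation P I * saturation P J ≤ saturation P (I * J) := by
  rw [Ideal.mul_le]
  rintro x ⟨s, hs, hx⟩ y ⟨t, ht, hy⟩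
  refine ⟨s * t, fun h => (hP.mem_or_mem h).elim hs ht, ?_⟩
  rw [mul_mul_mul_comm]
  exact Ideal.mul_mem_mul hx hy

theorem saturation_pow_le (n : ℕ) : saturation P I ^ n ≤ saturation P (I ^ n) := by
  induction n with
  | zero => simpa using le_saturation P (J := ⊤)
  | succ n ih => exact (Ideal.mul_mono_left ih).trans (saturation_mul_le P)

/-- Membership in an ideal is a local property. -/
theorem mem_of_forall_mem_saturation {x : R}
    (h : ∀ (m : Ideal R) [m.IsMaximal], x ∈ saturation m J) : x ∈ J := by
  by_contra hx
  obtain ⟨m, hm, hle⟩ := Ideal.exists_le_maximal (Submodule.colon J {x}) fun h => hx (by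
    have h1 : (1 : R) ∈ Submodule.colon J {x} := h ▸ Submodule.mem_top
    simpa using Submodule.mem_colon_singleton.1 h1)
  obtain ⟨s, hs, hsx⟩ := h m
  exact hs (hle (Submodule.mem_colon_singleton.2 hsx))

end Saturation

/-- The principal ideals of every localization of `R` at a prime ideal form a chain. -/
def LocallyComparable (R : Type*) [CommRing R] : Prop :=
  ∀ (m : Ideal R) [m.IsPrime] (a b : R),
    a ∈ saturation m (Ideal.span {b}) ∨ b ∈ saturation m (Ideal.span {a})

theorem IsArithmeticalRing.locallyComparable {R : Type*} [CommRing R] (hR : IsArithmeticalRing R) :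
    LocallyComparable R := by
  intro m hm a b
  -- Distributivity, applied to `(a) ⊆ (b) + (a - b)`.
  have ha : a ∈ Ideal.span {a} ⊓ (Ideal.span {b} ⊔ Ideal.span {a - b}) := by
    refine ⟨Ideal.mem_span_singleton_self a, ?_⟩
    have : b + (a - b) ∈ Ideal.span {b} ⊔ Ideal.span {a - b} :=
      Submodule.add_mem_sup (Ideal.mem_span_singleton_self _) (Ideal.mem_span_singleton_self _)
    simpa using this
  rw [hR] at ha
  obtain ⟨x, ⟨hxa, hxb⟩, y, ⟨hya, hyb⟩, hxy⟩ := Submodule.mem_sup.1 ha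
  obtain ⟨s, rfl⟩ := Ideal.mem_span_singleton'.1 hxa
  obtain ⟨t, rfl⟩ := Ideal.mem_span_singleton'.1 hya
  obtain ⟨t', ht'⟩ := Ideal.mem_span_singleton'.1 hyb
  by_cases hs : s ∈ m
  swap
  · exact Or.inl ⟨s, hs, hxb⟩
  by_cases ht : t ∈ m
  · refine Or.inl ⟨1 - s - t, fun h => m.one_notMem ?_, ?_⟩
    · have := m.add_mem (m.add_mem h hs) ht
      ring_nf at this
      exact this
    · have : (1 - s - t) * a = 0 := by linear_combination -hxy
      simp [this]
  -- Now `t a = t' (a - b)` with `t` a unit at `m`, so one of `t'` and `t - t'` is a unit as well.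
  by_cases h' : t' ∈ m
  · refine Or.inl ⟨t - t', fun h => ht (by simpa using m.add_mem h h'), ?_⟩
    exact Ideal.mem_span_singleton'.2 ⟨-t', by linear_combination ht'⟩
  · exact Or.inr ⟨t', h', Ideal.mem_span_singleton'.2 ⟨t' - t, by linear_combination ht'⟩⟩

theorem LocallyComparable.quotient {R : Type*} [CommRing R] (hR : LocallyComparable R)
    (I : Ideal R) : LocallyComparable (R ⧸ I) := by
  have key : ∀ (m : Ideal (R ⧸ I)) [m.IsPrime] (a b : R),
      a ∈ saturation (m.comap (Ideal.Quotient.mk I)) (Ideal.span {b}) →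
      Ideal.Quotient.mk I a ∈ saturation m (Ideal.span {Ideal.Quotient.mk I b}) := by
    rintro m _ a b ⟨s, hs, hsab⟩
    obtain ⟨r, hr⟩ := Ideal.mem_span_singleton'.1 hsab
    refine ⟨Ideal.Quotient.mk I s, hs, Ideal.mem_span_singleton'.2 ⟨Ideal.Quotient.mk I r, ?_⟩⟩
    rw [← map_mul, ← map_mul, hr]
  intro m _ a b
  obtain ⟨a, rfl⟩ := Ideal.Quotient.mk_surjective a
  obtain ⟨b, rfl⟩ := Ideal.Quotient.mk_surjective b
  exact (hR (m.comap (Ideal.Quotient.mk I)) a b).imp (key m a b) (key m b a)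

/-! ### Finite-dimensional factor rings -/

section FiniteDimensional

variable {R : Type*} [CommRing R]

/-- A sequence of submodules is independent as soon as each term is disjoint from a term of a
decreasing sequence of submodules that contains all later terms. -/
theorem iSupIndep_of_antitone {M : Type*} [AddCommGroup M] [Module R M] {C T : ℕ → Submodule R M}
    (hT : Antitone T) (hCT : ∀ n, C n ≤ T n) (h : ∀ n, C n ⊓ T (n + 1) = ⊥) : iSupIndep C := by
  rw [iSupIndep_iff_finsetSum_eq_zero_imp_eq_zero]
  intro s
  induction s using Finset.strongInduction with
  | H s ih =>
  intro v hv hsum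
  obtain rfl | hs := s.eq_empty_or_nonempty
  · simp
  -- The term of least index is the negative of the sum of the others.
  set i := s.min' hs
  have hi : i ∈ s := s.min'_mem hs
  have hrest : ∑ j ∈ s.erase i, v j ∈ T (i + 1) := Submodule.sum_mem _ fun j hj =>
    hT (Finset.min'_lt_of_mem_erase_min' s hs hj) (hCT j (hv j (Finset.mem_of_mem_erase hj)))
  rw [← Finset.add_sum_erase s v hi] at hsum
  have hvi : v i = 0 := by
    have : v i ∈ C i ⊓ T (i + 1) := ⟨hv i hi, by
      rw [eq_neg_of_add_eq_zero_left hsum]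
      exact neg_mem hrest⟩
    rwa [h, Submodule.mem_bot] at this
  rw [hvi, zero_add] at hsum
  intro j hj
  obtain rfl | hji := eq_or_ne j i
  · exact hvi
  · exact ih (s.erase i) (Finset.erase_ssubset hi) v
      (fun k hk => hv k (Finset.mem_of_mem_erase hk)) hsum j (Finset.mem_erase.2 ⟨hji, hj⟩)

/-- The form in which finite-dimensionality of `R / I` is used, in terms of ideals of `R`. -/
theorem IsFiniteDimensionalModule.false_of_antitone {I : Ideal R}
    (hI : IsFiniteDimensionalModule (R ⧸ I) (R ⧸ I)) {C T : ℕ → Ideal R} (hT : Antitone T)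
    (hIT : ∀ n, I ≤ T n) (hCT : ∀ n, C n ≤ T n) (hinf : ∀ n, C n ⊓ T (n + 1) ≤ I)
    (hC : ∀ n, ¬ C n ≤ I) : False := by
  refine hI ⟨fun n => (C n).map (Ideal.Quotient.mk I), fun n h => hC n ?_, ?_⟩
  · rwa [Ideal.map_eq_bot_iff_le_ker, Ideal.mk_ker] at h
  refine iSupIndep_of_antitone (T := fun n => (T n).map (Ideal.Quotient.mk I))
    (fun _ _ h => Ideal.map_mono (hT h)) (fun n => Ideal.map_mono (hCT n)) fun n => ?_
  rw [eq_bot_iff]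
  rintro _ ⟨hx, hy⟩
  obtain ⟨c, hc, rfl⟩ := (Ideal.mem_map_iff_of_surjective _ Ideal.Quotient.mk_surjective).1 hx
  obtain ⟨t, ht, htc⟩ := (Ideal.mem_map_iff_of_surjective _ Ideal.Quotient.mk_surjective).1 hy
  refine Ideal.Quotient.eq_zero_iff_mem.2 (hinf n ⟨hc, ?_⟩)
  have := (T (n + 1)).sub_mem ht (hIT _ (Ideal.Quotient.eq.1 htc))
  simpa using this

/-- An infinite direct sum gives a dense chain, consisting of the partial sums over sets of indices
of which each is obtained from a smaller one by adding infinitely many indices. -/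
theorem exists_denseBetween_of_iSupIndep {M : Type*} [AddCommGroup M] [Module R M]
    {f : ℕ → Submodule R M} (hf : ∀ i, f i ≠ ⊥) (hind : iSupIndep f) :
    ∃ a b : Submodule R M, DenseBetween a b := by
  refine ⟨⨆ i ∈ (∅ : Set ℕ), f i, ⨆ i ∈ (Set.univ : Set ℕ), f i, .of_isDenseRel
    (W := fun a b => ∃ S T : Set ℕ, S ⊆ T ∧ (T \ S).Infinite ∧
      ⨆ i ∈ S, f i = a ∧ ⨆ i ∈ T, f i = b) ?_
    ⟨∅, Set.univ, Set.empty_subset _, by simpa using Set.infinite_univ, rfl, rfl⟩⟩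
  rintro _ _ ⟨S, T, hST, hinf, rfl, rfl⟩
  refine ⟨lt_of_le_of_ne (biSup_mono hST) fun heq => ?_, ?_⟩
  · obtain ⟨n, hnT, hnS⟩ := hinf.nonempty
    have h1 : f n ≤ ⨆ i ∈ S, f i := heq ▸ le_biSup f hnT
    have h2 : ⨆ i ∈ S, f i ≤ ⨆ (j) (_ : j ≠ n), f j :=
      biSup_mono fun i hi => by rintro rfl; exact hnS hi
    exact hf n (le_bot_iff.1 (hind n le_rfl (h1.trans h2)))
  · obtain ⟨U, V, hUV, hdisj, hcard⟩ := hinf.exists_union_disjoint_cardinal_eq_of_infinite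
    have hUT : U ⊆ T \ S := hUV ▸ Set.subset_union_left
    have hVT : V ⊆ T \ S := hUV ▸ Set.subset_union_right
    have hfin : U.Finite ↔ V.Finite := by
      rw [← Cardinal.lt_aleph0_iff_set_finite, hcard, Cardinal.lt_aleph0_iff_set_finite]
    have hU : U.Infinite := fun h => hinf (hUV ▸ h.union (hfin.1 h))
    have hV : V.Infinite := fun h => hU (hfin.2 h)
    refine ⟨_, ⟨S, S ∪ U, Set.subset_union_left, hU.mono fun x hx => ⟨Or.inr hx, (hUT hx).2⟩,
      rfl, rfl⟩, ⟨S ∪ U, T, Set.union_subset hST fun x hx => (hUT hx).1,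
      hV.mono fun x hx => ⟨(hVT hx).1, ?_⟩, rfl, rfl⟩⟩
    rintro (hS | hxU)
    · exact (hVT hx).2 hS
    · exact Set.disjoint_left.1 hdisj hxU hx

end FiniteDimensional

/-! ### Idempotent ideals in rings with Krull dimension -/

section Idempotent

variable {R : Type*} [CommRing R]

/-- Locally, every element of an idempotent ideal is a product of two elements of the ideal. -/
theorem LocallyComparable.exists_mul_eq_of_mem (hR : LocallyComparable R) (m : Ideal R)
    [hm : m.IsPrime] {B : Ideal R} {d : R} (hd : d ∈ B * B) :
    ∃ u ∉ m, ∃ d₁ ∈ B, ∃ d₂ ∈ B, u * d = d₁ * d₂ := by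
  have hmul : ∀ {x y : R}, x ∉ m → y ∉ m → x * y ∉ m := fun hx hy h =>
    (hm.mem_or_mem h).elim hx hy
  -- If `d₁` is locally a multiple of `d₁'`, then `d₁ d₂ + d₁' d₂'` is locally a multiple of `d₁'`.
  have key : ∀ {x y u d₁ d₂ u' d₁' d₂' : R}, u ∉ m → u' ∉ m → d₁' ∈ B → d₂ ∈ B → d₂' ∈ B →
      u * x = d₁ * d₂ → u' * y = d₁' * d₂' → d₁ ∈ saturation m (Ideal.span {d₁'}) →
      ∃ u ∉ m, ∃ d₁ ∈ B, ∃ d₂ ∈ B, u * (x + y) = d₁ * d₂ := by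
    rintro x y u d₁ d₂ u' d₁' d₂' hu hu' hd₁' hd₂ hd₂' hx hy ⟨s, hs, hsd⟩
    obtain ⟨r, hr⟩ := Ideal.mem_span_singleton'.1 hsd
    refine ⟨s * u * u', hmul (hmul hs hu) hu', d₁', hd₁', u' * r * d₂ + s * u * d₂',
      B.add_mem (B.mul_mem_left _ hd₂) (B.mul_mem_left _ hd₂'), ?_⟩
    linear_combination (s * u') * hx + (s * u) * hy - u' * d₂ * hr
  induction hd using Submodule.mul_induction_on' with
  | mem_mul_mem x hx y hy => exact ⟨1, m.one_notMem, x, hx, y, hy, one_mul _⟩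
  | add x _ y _ ihx ihy =>
    obtain ⟨u, hu, d₁, hd₁, d₂, hd₂, hx⟩ := ihx
    obtain ⟨u', hu', d₁', hd₁', d₂', hd₂', hy⟩ := ihy
    obtain h | h := hR m d₁ d₁'
    · exact key hu hu' hd₁' hd₂ hd₂' hx hy h
    · rw [add_comm]
      exact key hu' hu hd₁ hd₂' hd₂ hy hx h

/-- If an idempotent ideal `B ≤ m` does not vanish locally at `m`, then there is a dense chain of
ideals: the ideals `(c d) < (c)` of the localization with `d ∈ B` and `c d ≠ 0` form a dense
relation, because `d` can be factored inside `B`. -/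
theorem exists_denseBetween_of_idempotent (hR : LocallyComparable R) (m : Ideal R) [hm : m.IsPrime]
    {B : Ideal R} (hB : B ≤ B * B) (hBm : B ≤ m) {b : R} (hb : b ∈ B)
    (hb0 : b ∉ saturation m (⊥ : Ideal R)) : ∃ X Y : Ideal R, DenseBetween X Y := by
  refine ⟨_, _, .of_isDenseRel (W := fun X Y => ∃ c d, d ∈ B ∧ c * d ∉ saturation m (⊥ : Ideal R) ∧
    X = saturation m (Ideal.span {c * d}) ∧ Y = saturation m (Ideal.span {c})) ?_
    ⟨1, b, hb, by rwa [one_mul], rfl, rfl⟩⟩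
  rintro _ _ ⟨c, d, hd, hcd, rfl, rfl⟩
  refine ⟨lt_of_le_not_ge (saturation_mono m ?_) fun hle => ?_, ?_⟩
  · rw [Ideal.span_singleton_le_iff_mem]
    exact Ideal.mul_mem_right _ _ (Ideal.mem_span_singleton_self c)
  · obtain ⟨s, hs, hsc⟩ := hle (le_saturation m (Ideal.mem_span_singleton_self c))
    obtain ⟨r, hr⟩ := Ideal.mem_span_singleton'.1 hsc
    -- `c (s - d r) = 0` and `s - d r` is a unit at `m`.
    refine hcd (Ideal.mul_mem_right _ _ ⟨s - d * r, fun h => hs ?_, ?_⟩)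
    · simpa using m.add_mem h (m.mul_mem_right r (hBm hd))
    · rw [Ideal.mem_bot]
      linear_combination -hr
  · obtain ⟨u, hu, d₁, hd₁, d₂, hd₂, h⟩ := hR.exists_mul_eq_of_mem m (hB hd)
    have hfac : c * d₁ * d₂ = u * (c * d) := by linear_combination -c * h
    have hne : c * d₁ * d₂ ∉ saturation m (⊥ : Ideal R) := fun h' =>
      hcd (mem_saturation_of_mul_mem m hu (hfac ▸ h'))
    refine ⟨saturation m (Ideal.span {c * d₁}), ⟨c * d₁, d₂, hd₂, hne, ?_, rfl⟩,
      ⟨c, d₁, hd₁, fun h' => hne (Ideal.mul_mem_right _ _ h'), rfl, rfl⟩⟩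
    rw [hfac, saturation_span_mul m hu]

/-- Without dense chains of ideals, an idempotent ideal is pure. -/
theorem exists_mul_eq_self_of_idempotent (hR : LocallyComparable R)
    (hdense : ∀ X Y : Ideal R, ¬ DenseBetween X Y) {B : Ideal R} (hB : B ≤ B * B) {b : R}
    (hb : b ∈ B) : ∃ e ∈ B, e * b = b := by
  by_cases htop : Submodule.colon (⊥ : Ideal R) {b} ⊔ B = ⊤
  · obtain ⟨s, hs, e, he, hse⟩ := Submodule.mem_sup.1 (htop ▸ Submodule.mem_top : (1 : R) ∈ _)
    have hsb : s * b = 0 := by simpa using Submodule.mem_colon_singleton.1 hs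
    exact ⟨e, he, by linear_combination b * hse - hsb⟩
  · obtain ⟨m, hm, hle⟩ := Ideal.exists_le_maximal _ htop
    obtain ⟨X, Y, h⟩ := exists_denseBetween_of_idempotent hR m hB (le_sup_right.trans hle) hb
      fun ⟨s, hs, hsb⟩ => hs (hle (Ideal.mem_sup_left (Submodule.mem_colon_singleton.2 hsb)))
    exact absurd h (hdense X Y)

/-- A pure essential ideal of a finite-dimensional ring is the whole ring. Otherwise there are
`b₀, b₁, …` in the ideal with `bₙ₊₁ bₙ = bₙ` and `bₙ₊₁ (1 - bₙ) ≠ 0`, and every third of the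
elements `bₙ₊₁ (1 - bₙ)` generates a term of an infinite direct sum. -/
theorem eq_top_of_pure_of_isEssentialSubmodule
    (hfd : IsFiniteDimensionalModule (R ⧸ (⊥ : Ideal R)) (R ⧸ (⊥ : Ideal R))) {B : Ideal R}
    (hpure : ∀ b ∈ B, ∃ e ∈ B, e * b = b) (hess : IsEssentialSubmodule B) : B = ⊤ := by
  by_contra htop
  have hstep : ∀ b : B, ∃ b' : B, b'.1 * b.1 = b.1 ∧ b'.1 * (1 - b.1) ≠ 0 := by
    rintro ⟨b, hb⟩
    have hne : Ideal.span {1 - b} ≠ (⊥ : Ideal R) := by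
      rw [Ne, Ideal.span_singleton_eq_bot]
      intro h
      exact htop (B.eq_top_of_isUnit_mem hb (sub_eq_zero.1 h ▸ isUnit_one))
    obtain ⟨c, ⟨hcB, hc⟩, hc0⟩ := Submodule.exists_mem_ne_zero_of_ne_bot (hess _ hne)
    obtain ⟨r, hr⟩ := Ideal.mem_span_singleton'.1 hc
    obtain ⟨e₁, he₁, h₁⟩ := hpure b hb
    obtain ⟨e₂, he₂, h₂⟩ := hpure c hcB
    refine ⟨⟨e₁ + e₂ - e₁ * e₂, B.sub_mem (B.add_mem he₁ he₂) (B.mul_mem_left _ he₂)⟩, ?_,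
      fun h => hc0 ?_⟩
    · change (e₁ + e₂ - e₁ * e₂) * b = b
      linear_combination (1 - e₂) * h₁
    · change (e₁ + e₂ - e₁ * e₂) * (1 - b) = 0 at h
      linear_combination r * h + (e₁ - 1) * h₂ - (e₁ + e₂ - e₁ * e₂) * hr
  choose g hg₁ hg₂ using hstep
  let f : ℕ → B := fun n => g^[n] ⟨0, B.zero_mem⟩
  have hf : ∀ n, f (n + 1) = g (f n) := fun n => Function.iterate_succ_apply' _ _ _
  have h₁ : ∀ n, (f (n + 1)).1 * (f n).1 = (f n).1 := fun n => hf n ▸ hg₁ (f n)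
  have h₂ : ∀ n, (f (n + 1)).1 * (1 - (f n).1) ≠ 0 := fun n => hf n ▸ hg₂ (f n)
  have hanti : Antitone fun n => Submodule.colon (⊥ : Ideal R) {(f n).1} := by
    refine antitone_nat_of_succ_le fun n x hx => ?_
    rw [Submodule.mem_colon_singleton, Ideal.mem_bot, smul_eq_mul] at hx ⊢
    rw [← h₁ n, ← mul_assoc, hx, zero_mul]
  refine hfd.false_of_antitone
    (C := fun n => Ideal.span {(f (3 * n + 2)).1 * (1 - (f (3 * n + 1)).1)})
    (T := fun n => Submodule.colon (⊥ : Ideal R) {(f (3 * n)).1})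
    (fun m n h => hanti (Nat.mul_le_mul_left 3 h)) (fun _ => bot_le) (fun n => ?_) (fun n => ?_)
    (fun n h => h₂ (3 * n + 1) ?_)
  · rw [Ideal.span_singleton_le_iff_mem, Submodule.mem_colon_singleton, Ideal.mem_bot, smul_eq_mul]
    linear_combination -(f (3 * n + 2)).1 * h₁ (3 * n)
  · rintro x ⟨hx, hx'⟩
    obtain ⟨r, rfl⟩ := Ideal.mem_span_singleton'.1 hx
    have hx' := Submodule.mem_colon_singleton.1 hx'
    rw [Ideal.mem_bot, smul_eq_mul, show 3 * (n + 1) = 3 * n + 2 + 1 by ring] at hx'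
    rw [Ideal.mem_bot]
    linear_combination hx' - r * (1 - (f (3 * n + 1)).1) * h₁ (3 * n + 2)
  · simpa using h

end Idempotent

/-! ### Products of ideals with Krull dimension -/

section Products

variable {R : Type*} [CommRing R]

/-- Over a ring with finite-dimensional factor rings, the existence of dense chains between two
ideals is detected by principal extensions of the smaller ideal. A dense interval `[a, b]` contains
`x ∈ b` and a dense interval `[a', b']` with `x ∉ b'` and `(x) ∩ b' ⊆ a'`; iterating, the elements
`x` generate an infinite direct sum modulo the union of the ideals `a`. -/
theorem not_denseBetween_of_forall_mem
    (hfd : ∀ I : Ideal R, IsFiniteDimensionalModule (R ⧸ I) (R ⧸ I)) {J K : Ideal R}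
    (h : ∀ x ∈ K, ¬ DenseBetween J (J ⊔ Ideal.span {x})) : ¬ DenseBetween J K := by
  intro hJK
  let S := {p : Ideal R × Ideal R // J ≤ p.1 ∧ p.2 ≤ K ∧ DenseBetween p.1 p.2}
  have hstep : ∀ p : S, ∃ (q : S) (x : R), p.1.1 ≤ q.1.1 ∧ q.1.2 ≤ p.1.2 ∧ x ∈ p.1.2 ∧
      x ∉ q.1.2 ∧ Ideal.span {x} ⊓ q.1.2 ≤ q.1.1 := by
    rintro ⟨⟨a, b⟩, hJa, hbK, hab⟩
    obtain ⟨c, hac, hcb⟩ := hab.exists_between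
    obtain ⟨x, hxb, hxc⟩ := SetLike.exists_of_lt hcb.lt
    obtain ⟨a', b', ha, hb, h', he⟩ := hac.exists_inf_eq (c := J ⊔ Ideal.span {x}) fun hd =>
      h x (hbK hxb) (hd.mono (le_inf hJa le_sup_left) inf_le_right)
    refine ⟨⟨(a', b'), hJa.trans ha, (hb.trans hcb.lt.le).trans hbK, h'⟩, x, ha,
      hb.trans hcb.lt.le, hxb, fun hx => hxc (hb hx), ?_⟩
    calc Ideal.span {x} ⊓ b' ≤ b' ⊓ (J ⊔ Ideal.span {x}) :=
          le_inf inf_le_right (inf_le_left.trans le_sup_right)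
      _ ≤ a' := he ▸ inf_le_left
  choose g x hg₁ hg₂ hx hx' hinf using hstep
  let f : ℕ → S := fun n => g^[n] ⟨(J, K), le_rfl, le_rfl, hJK⟩
  have hf : ∀ n, f (n + 1) = g (f n) := fun n => Function.iterate_succ_apply' _ _ _
  have hmono : Monotone fun n => (f n).1.1 := monotone_nat_of_le_succ fun n => hf n ▸ hg₁ (f n)
  have hanti : Antitone fun n => (f n).1.2 := antitone_nat_of_succ_le fun n => hf n ▸ hg₂ (f n)
  have hle : ∀ n, ⨆ k, (f k).1.1 ≤ (f n).1.2 := fun n => iSup_le fun k =>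
    (hmono (le_max_left k n)).trans ((f (max k n)).2.2.2.lt.le.trans (hanti (le_max_right k n)))
  refine (hfd (⨆ k, (f k).1.1)).false_of_antitone (C := fun n => Ideal.span {x (f n)}) hanti hle
    (fun n => ?_) (fun n => ?_) (fun n hn => ?_)
  · rw [Ideal.span_singleton_le_iff_mem]
    exact hx (f n)
  · refine le_trans ?_ (le_iSup _ (n + 1))
    rw [hf]
    exact hinf (f n)
  · refine hx' (f n) ?_
    rw [← hf]
    exact hle (n + 1) (hn (Ideal.mem_span_singleton_self _))

/-- The ideals `P` for which `R / P` has Krull dimension are closed under products: `Q / Q P` is an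
`R / P`-module, so its cyclic submodules are images of `R / P`. -/
theorem not_denseBetween_mul_top
    (hfd : ∀ I : Ideal R, IsFiniteDimensionalModule (R ⧸ I) (R ⧸ I)) {P Q : Ideal R}
    (hP : ¬ DenseBetween P ⊤) (hQ : ¬ DenseBetween Q ⊤) : ¬ DenseBetween (Q * P) ⊤ := by
  refine DenseBetween.trans_not Ideal.mul_le_left le_top
    (not_denseBetween_of_forall_mem hfd fun x hx h => hP ?_) hQ
  refine (h.map (φ := fun Y => Submodule.colon Y {x}) fun Y Z hY hZ hYZ => ?_).mono
    (fun p hp => ?_) le_top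
  · refine lt_of_le_not_ge (Submodule.colon_mono hYZ.lt.le subset_rfl) fun hle => ?_
    obtain ⟨z, hzZ, hzY⟩ := SetLike.exists_of_lt hYZ.lt
    obtain ⟨j, hj, y, hy, rfl⟩ := Submodule.mem_sup.1 (hZ hzZ)
    obtain ⟨r, rfl⟩ := Ideal.mem_span_singleton'.1 hy
    have hr : r ∈ Submodule.colon Z {x} := Submodule.mem_colon_singleton.2 (by
      simpa using Z.sub_mem hzZ (hYZ.lt.le (hY hj)))
    exact hzY (Y.add_mem (hY hj) (Submodule.mem_colon_singleton.1 (hle hr)))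
  · rw [Submodule.mem_colon_singleton, smul_eq_mul, mul_comm p x]
    exact Ideal.mul_mem_mul hx hp

theorem not_denseBetween_prod_pow_top
    (hfd : ∀ I : Ideal R, IsFiniteDimensionalModule (R ⧸ I) (R ⧸ I)) (s : Finset (Ideal R))
    (k : Ideal R → ℕ) (hs : ∀ P ∈ s, ¬ DenseBetween P ⊤) :
    ¬ DenseBetween (∏ P ∈ s, P ^ k P) ⊤ := by
  have htop : ¬ DenseBetween (1 : Ideal R) ⊤ := fun h => h.lt.ne Ideal.one_eq_top
  refine Finset.prod_induction _ (fun Q => ¬ DenseBetween Q ⊤)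
    (fun _ _ h₁ h₂ => not_denseBetween_mul_top hfd h₂ h₁) htop fun P hP => ?_
  induction k P with
  | zero => rwa [pow_zero]
  | succ n ih => exact pow_succ P n ▸ not_denseBetween_mul_top hfd (hs P hP) ih

end Products

/-! ### Finiteness of the set of minimal primes -/

section MinimalPrimes

variable {R : Type*} [CommRing R]

/-- In a reduced ring, an ideal whose annihilator is not a finite intersection of prime ideals
contains two ideals with zero intersection, one of them nonzero and the other of the same kind.
Everything is stated modulo a radical ideal `N`. -/
theorem exists_disjoint_of_not_finite_inf {N I : Ideal R} (hN : N.IsRadical) (hNI : N ≤ I)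
    (hI : ¬ ∃ s : Finset (Ideal R), (∀ P ∈ s, P.IsPrime) ∧ N.colon I = s.inf id) :
    ∃ C I' : Ideal R, N ≤ I' ∧ I' ≤ I ∧ C ≤ I ∧ ¬ C ≤ N ∧ C ⊓ I' ≤ N ∧
      ¬ ∃ s : Finset (Ideal R), (∀ P ∈ s, P.IsPrime) ∧ N.colon I' = s.inf id := by
  classical
  have hsq : ∀ {z : R}, z * z ∈ N → z ∈ N := fun {z} h => hN ⟨2, by rwa [pow_two]⟩
  have hmem : ∀ {I : Ideal R} {y : R}, y ∈ N.colon (I : Set R) ↔ ∀ i ∈ I, y * i ∈ N :=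
    Submodule.mem_colon
  have hne : N.colon (I : Set R) ≠ ⊤ := fun h => hI ⟨∅, by simp, by simpa using h⟩
  have hnp : ¬ (N.colon (I : Set R)).IsPrime := fun h =>
    hI ⟨{N.colon (I : Set R)}, by simpa using h, by simp⟩
  rw [Ideal.isPrime_iff] at hnp
  push Not at hnp
  obtain ⟨a, b, hab, ha, hb⟩ := hnp hne
  set I₁ : Ideal R := Ideal.span {a} * I ⊔ N
  set I₂ : Ideal R := I ⊓ N.colon (I₁ : Set R)
  have h₁I : I₁ ≤ I := sup_le Ideal.mul_le_right hNI
  have hN₂ : N ≤ I₂ := le_inf hNI fun x hx => hmem.2 fun i _ => N.mul_mem_right _ hx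
  have h₁ : ¬ I₁ ≤ N := fun h => ha (hmem.2 fun i hi => h (Ideal.mem_sup_left
    (Ideal.mul_mem_mul (Ideal.mem_span_singleton_self a) hi)))
  have h₂ : ¬ I₂ ≤ N := by
    refine fun h => hb (hmem.2 fun i hi => h ⟨I.mul_mem_left b hi, hmem.2 fun j hj => ?_⟩)
    obtain ⟨y, hy, n, hn, rfl⟩ := Submodule.mem_sup.1 hj
    obtain ⟨i', hi', rfl⟩ := Ideal.mem_span_singleton_mul.1 hy
    have := N.mul_mem_left i (hmem.1 hab i' hi')
    have h' : b * i * (a * i' + n) = i * (a * b * i') + b * i * n := by ring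
    rw [h']
    exact N.add_mem this (N.mul_mem_left _ hn)
  have hdisj : I₁ ⊓ I₂ ≤ N := fun z hz => hsq (hmem.1 hz.2.2 z hz.1)
  have hcolon : N.colon (I : Set R) = N.colon (I₁ : Set R) ⊓ N.colon (I₂ : Set R) := by
    refine le_antisymm (le_inf (Submodule.colon_mono le_rfl h₁I)
      (Submodule.colon_mono le_rfl inf_le_left)) fun y hy => hmem.2 fun i hi => hsq ?_
    have hyi : y * i ∈ I₂ := ⟨I.mul_mem_left y hi, hmem.2 fun j hj => by
      rw [mul_right_comm]
      exact N.mul_mem_right _ (hmem.1 hy.1 j hj)⟩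
    have hsq' : y * i * (y * i) = y * (y * i) * i := by ring
    exact hsq' ▸ N.mul_mem_right i (hmem.1 hy.2 _ hyi)
  by_cases hbad : ∃ s : Finset (Ideal R), (∀ P ∈ s, P.IsPrime) ∧ N.colon (I₁ : Set R) = s.inf id
  · refine ⟨I₁, I₂, hN₂, inf_le_left, h₁I, h₁, hdisj, fun ⟨t, ht, ht'⟩ => hI ?_⟩
    obtain ⟨s, hs, hs'⟩ := hbad
    refine ⟨s ∪ t, fun P hP => (Finset.mem_union.1 hP).elim (hs P) (ht P), ?_⟩
    rw [hcolon, hs', ht', Finset.inf_union]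
  · exact ⟨I₂, I₁, le_sup_right, h₁I, inf_le_left, h₂, inf_comm I₁ I₂ ▸ hdisj, hbad⟩

/-- Repeated splitting (`exists_disjoint_of_not_finite_inf`) would give an infinite direct sum, so the
radical of `J` is a finite intersection of primes, among which are all minimal primes of `J`. -/
theorem finite_minimalPrimes_of_isFiniteDimensionalModule (J : Ideal R)
    (hfd : IsFiniteDimensionalModule (R ⧸ J.radical) (R ⧸ J.radical)) :
    J.minimalPrimes.Finite := by
  set N := J.radical
  have hN : N.IsRadical := Ideal.radical_isRadical J
  suffices h : ∃ s : Finset (Ideal R), (∀ P ∈ s, P.IsPrime) ∧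
      N.colon ((⊤ : Ideal R) : Set R) = s.inf id by
    obtain ⟨s, hs, hs'⟩ := h
    rw [Submodule.top_coe, Submodule.colon_univ] at hs'
    refine s.finite_toSet.subset fun P hP => ?_
    have hle : s.inf id ≤ P := hs' ▸ (hP.1.1.radical_le_iff.2 hP.1.2)
    obtain ⟨Q, hQ, hQP⟩ := hP.1.1.inf_le'.1 hle
    have hJQ : J ≤ Q := Ideal.le_radical.trans (hs'.le.trans (Finset.inf_le hQ))
    exact (le_antisymm hQP (hP.2 ⟨hs Q hQ, hJQ⟩ hQP) : Q = P) ▸ hQ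
  by_contra hbad
  let S := {I : Ideal R // N ≤ I ∧
    ¬ ∃ s : Finset (Ideal R), (∀ P ∈ s, P.IsPrime) ∧ N.colon (I : Set R) = s.inf id}
  have hstep : ∀ I : S, ∃ (I' : S) (C : Ideal R), I'.1 ≤ I.1 ∧ C ≤ I.1 ∧ ¬ C ≤ N ∧ C ⊓ I'.1 ≤ N := by
    rintro ⟨I, hNI, hI⟩
    obtain ⟨C, I', h₁, h₂, h₃, h₄, h₅, h₆⟩ := exists_disjoint_of_not_finite_inf hN hNI hI
    exact ⟨⟨I', h₁, h₆⟩, C, h₂, h₃, h₄, h₅⟩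
  choose g C hg hC hCN hinf using hstep
  let f : ℕ → S := fun n => g^[n] ⟨⊤, le_top, hbad⟩
  have hf : ∀ n, f (n + 1) = g (f n) := fun n => Function.iterate_succ_apply' _ _ _
  refine hfd.false_of_antitone (C := fun n => C (f n)) (T := fun n => (f n).1)
    (antitone_nat_of_succ_le fun n => hf n ▸ hg (f n)) (fun n => (f n).2.1) (fun n => hC (f n))
    (fun n => ?_) (fun n => hCN (f n))
  rw [hf]
  exact hinf (f n)

end MinimalPrimes

/-! ### Rings whose factor rings have no idempotent proper essential ideals -/

section NoIdempotent

variable {R : Type*} [CommRing R]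

/-- If no factor ring has an idempotent proper essential ideal, then every idempotent ideal of a
factor ring is a direct summand. Indeed it becomes essential modulo an ideal that is maximal among
those intersecting it trivially. -/
theorem exists_compl_of_idempotent
    (hid : ∀ I : Ideal R,
      ¬ ∃ B : Ideal (R ⧸ I), B = B ^ 2 ∧ B ≠ ⊤ ∧ IsEssentialSubmodule B)
    {I Q : Ideal R} (hQ : Q ≤ Q * Q ⊔ I) : ∃ C : Ideal R, Q ⊓ C ≤ I ∧ Q ⊔ C = ⊤ := by
  obtain ⟨C, hIC, hC, hmax⟩ := zorn_le_nonempty₀ {C : Ideal R | Q ⊓ C ≤ I}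
    (fun c hc hchain y hy => by
      refine ⟨sSup c, fun x ⟨hxQ, hx⟩ => ?_, fun z hz => le_sSup hz⟩
      obtain ⟨z, hz, hxz⟩ := (Submodule.mem_sSup_of_directed ⟨y, hy⟩ hchain.directedOn).1 hx
      exact hc hz ⟨hxQ, hxz⟩) I (inf_le_right : Q ⊓ I ≤ I)
  refine ⟨C, hC, ?_⟩
  by_contra htop
  refine hid C ⟨Q.map (Ideal.Quotient.mk C), le_antisymm ?_ (Ideal.pow_le_self two_ne_zero),
    fun h => htop ?_, fun Y hY h => hY ?_⟩
  · refine (Ideal.map_mono hQ).trans ?_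
    rw [Ideal.map_sup, Ideal.map_mul, ← pow_two]
    refine sup_le le_rfl ((Ideal.map_mono hIC).trans ?_)
    rw [Ideal.map_quotient_self]
    exact bot_le
  · have := congrArg (Ideal.comap (Ideal.Quotient.mk C)) h
    rwa [Ideal.comap_map_of_surjective _ Ideal.Quotient.mk_surjective, Ideal.comap_top,
      ← RingHom.ker_eq_comap_bot, Ideal.mk_ker] at this
  -- If `Y` meets the image of `Q` trivially, its preimage meets `Q` within `I`, so it equals `C`.
  · have hY' : Ideal.comap (Ideal.Quotient.mk C) Y ≤ C := by
      refine hmax (y := Ideal.comap (Ideal.Quotient.mk C) Y)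
        (fun x ⟨hxQ, hxY⟩ => hC ⟨hxQ, ?_⟩)
        fun x hx => ?_
      · have : Ideal.Quotient.mk C x ∈ Q.map (Ideal.Quotient.mk C) ⊓ Y :=
          ⟨Ideal.mem_map_of_mem _ hxQ, hxY⟩
        rw [h, Submodule.mem_bot] at this
        exact Ideal.Quotient.eq_zero_iff_mem.1 this
      · rw [Ideal.mem_comap, Ideal.Quotient.eq_zero_iff_mem.2 hx]
        exact Y.zero_mem
    rw [eq_bot_iff]
    intro y hy
    obtain ⟨x, rfl⟩ := Ideal.Quotient.mk_surjective y
    exact Ideal.Quotient.eq_zero_iff_mem.2 (hY' hy)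

/-- The ascending chain condition on prime ideals: the union of an ascending chain of primes that
does not stabilize is idempotent. -/
theorem LocallyComparable.wellFoundedGT_primeSpectrum (hR : LocallyComparable R)
    (hid : ∀ I : Ideal R,
      ¬ ∃ B : Ideal (R ⧸ I), B = B ^ 2 ∧ B ≠ ⊤ ∧ IsEssentialSubmodule B) :
    WellFoundedGT (PrimeSpectrum R) := by
  rw [wellFoundedGT_iff_monotone_chain_condition']
  intro a
  by_contra! hlt
  set Q : Ideal R := ⨆ n, (a n).asIdeal
  have hmem : ∀ {x}, x ∈ Q ↔ ∃ n, x ∈ (a n).asIdeal := fun {x} =>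
    Submodule.mem_iSup_of_directed _ (Monotone.directed_le fun _ _ h => a.monotone h)
  have hle : ∀ n, (a n).asIdeal ≤ Q := fun n => le_iSup (fun n => (a n).asIdeal) n
  have hQ : Q ≤ Q * Q := by
    refine fun x hx => mem_of_forall_mem_saturation fun m hm => ?_
    by_cases hQm : Q ≤ m
    · obtain ⟨i, hi⟩ := hmem.1 hx
      obtain ⟨j, -, hij⟩ := hlt i
      obtain ⟨y, hyj, hyi⟩ := SetLike.exists_of_lt (PrimeSpectrum.asIdeal_lt_asIdeal _ _ |>.2 hij)
      obtain ⟨s, hs, hsx⟩ | ⟨s, hs, hsy⟩ := hR m x y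
      · obtain ⟨r, hr⟩ := Ideal.mem_span_singleton'.1 hsx
        have hri : r * y ∈ (a i).asIdeal := hr ▸ Ideal.mul_mem_left _ _ hi
        have hr' : r ∈ Q := hle i (((a i).2.mem_or_mem hri).resolve_right hyi)
        exact ⟨s, hs, hr ▸ Ideal.mul_mem_mul hr' (hle j hyj)⟩
      · have hsi : s * y ∈ (a i).asIdeal := (Ideal.span_singleton_le_iff_mem _).2 hi hsy
        exact absurd (((a i).2.mem_or_mem hsi).resolve_right hyi) fun h => hs (hQm (hle i h))
    · obtain ⟨p, hp, hpm⟩ := SetLike.not_le_iff_exists.1 hQm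
      exact ⟨p, hpm, Ideal.mul_mem_mul hp hx⟩
  obtain ⟨C, hC, hQC⟩ := exists_compl_of_idempotent hid (I := (a 0).asIdeal)
    (hQ.trans le_sup_left)
  obtain h | h := (a 0).2.mul_le.1 (Ideal.mul_le_inf.trans hC)
  · obtain ⟨j, -, hj⟩ := hlt 0
    exact (PrimeSpectrum.asIdeal_lt_asIdeal _ _ |>.2 hj).not_ge ((hle j).trans h)
  · rw [sup_eq_left.2 (h.trans (hle 0)), Ideal.eq_top_iff_one, hmem] at hQC
    obtain ⟨n, hn⟩ := hQC
    exact (a n).2.one_notMem hn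

/-- Some power of a prime `P` which is minimal over `J` vanishes in the localization of `R / J` at
`P`. The maximal ideal of this local ring consists of nilpotent elements; it is either idempotent,
and then it is zero, or its square lies in a principal ideal. -/
theorem LocallyComparable.exists_pow_le_saturation (hR : LocallyComparable R)
    (hid : ∀ I : Ideal R,
      ¬ ∃ B : Ideal (R ⧸ I), B = B ^ 2 ∧ B ≠ ⊤ ∧ IsEssentialSubmodule B)
    {J P : Ideal R} [hP : P.IsPrime] (hPJ : P ∈ J.minimalPrimes) :
    ∃ k, P ^ k ≤ saturation P J := by
  set K := saturation P J
  have hnil : ∀ p ∈ P, ∃ n, p ^ n ∈ K := by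
    intro p hp
    by_contra! hn
    have hdisj : Disjoint (J : Set R) (P.primeCompl ⊔ Submonoid.powers p : Submonoid R) := by
      rw [Set.disjoint_left]
      intro x hx hx'
      obtain ⟨s, hs, _, ⟨n, rfl⟩, rfl⟩ := Submonoid.mem_sup.1 hx'
      exact hn n ⟨s, hs, hx⟩
    obtain ⟨q, hq, hJq, hqd⟩ := Ideal.exists_le_prime_disjoint J _ hdisj
    have hqP : q ≤ P := fun x hx => by
      by_contra hxP
      exact Set.disjoint_left.1 hqd hx ((le_sup_left : P.primeCompl ≤ _) hxP)
    exact Set.disjoint_left.1 hqd (hPJ.2 ⟨hq, hJq⟩ hqP hp)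
      ((le_sup_right : Submonoid.powers p ≤ _) (Submonoid.mem_powers p))
  by_cases hPP : P ≤ P * P ⊔ K
  · obtain ⟨C, hC, hPC⟩ := exists_compl_of_idempotent hid hPP
    have hCP : ¬ C ≤ P := fun h => hP.ne_top (sup_eq_left.2 h ▸ hPC)
    obtain ⟨c, hc, hcP⟩ := SetLike.not_le_iff_exists.1 hCP
    refine ⟨1, fun p hp => mem_saturation_of_mul_mem P hcP (hC ⟨?_, C.mul_mem_right _ hc⟩)⟩
    rw [pow_one] at hp
    exact P.mul_mem_left _ hp
  · obtain ⟨π, hπP, hπ⟩ := SetLike.not_le_iff_exists.1 hPP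
    have hloc : ∀ s ∉ P, s * π ∉ P * P := by
      refine fun s hs hsπ => hπ (mem_of_forall_mem_saturation fun m hm => ?_)
      by_cases hPm : P ≤ m
      -- Locally at `m`, the element `s` divides every element of `P`.
      · have h₁ : P ≤ saturation m (Ideal.span {s} * P) := by
          intro x hx
          obtain ⟨u, hu, h⟩ | ⟨u, hu, h⟩ := hR m x s
          · obtain ⟨r, hr⟩ := Ideal.mem_span_singleton'.1 h
            have hrs : r * s ∈ P := hr ▸ P.mul_mem_left _ hx
            have hrP : r ∈ P := (hP.mem_or_mem hrs).resolve_right hs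
            refine ⟨u, hu, ?_⟩
            rw [← hr, mul_comm r s]
            exact Ideal.mul_mem_mul (Ideal.mem_span_singleton_self s) hrP
          · have hus : u * s ∈ P := (Ideal.span_singleton_le_iff_mem _).2 hx h
            exact absurd ((hP.mem_or_mem hus).resolve_right hs) fun h => hu (hPm h)
        have h₂ : P * P ≤ saturation m (Ideal.span {s} * P * P) :=
          (Ideal.mul_mono h₁ (le_saturation m)).trans (saturation_mul_le m)
        obtain ⟨u, hu, h⟩ := h₂ hsπ
        rw [mul_assoc] at h
        obtain ⟨c, hc, hcu⟩ := Ideal.mem_span_singleton_mul.1 h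
        have hdiff : u * π - c ∈ K := ⟨s, hs, by
          have : s * (u * π - c) = 0 := by linear_combination -hcu
          rw [this]
          exact J.zero_mem⟩
        refine ⟨u, hu, ?_⟩
        rw [← add_sub_cancel c (u * π)]
        exact Submodule.add_mem_sup hc hdiff
      · obtain ⟨p, hp, hpm⟩ := SetLike.not_le_iff_exists.1 hPm
        obtain ⟨n, hn⟩ := hnil p hp
        exact ⟨p ^ n, fun h => hpm (hm.isPrime.mem_of_pow_mem n h),
          Ideal.mem_sup_right (K.mul_mem_right _ hn)⟩
    have hsq : P * P ≤ saturation P (Ideal.span {π}) := fun x hx =>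
      (hR P x π).resolve_right fun ⟨s, hs, h⟩ =>
        hloc s hs ((Ideal.span_singleton_le_iff_mem _).2 hx h)
    obtain ⟨n, hn⟩ := hnil π hπP
    refine ⟨2 * n, ?_⟩
    rw [pow_mul, pow_two]
    refine (Ideal.pow_right_mono hsq n).trans ((saturation_pow_le P n).trans ?_)
    rwa [saturation_le_iff, Ideal.span_singleton_pow, Ideal.span_singleton_le_iff_mem]

/-- Some power of a prime `P` which is minimal over `J` vanishes in the localizations of `R / J` at
all primes above `P`, since there `P` is divisible by the elements outside `P`. -/
theorem LocallyComparable.exists_pow_le_saturation_of_le (hR : LocallyComparable R)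
    (hid : ∀ I : Ideal R,
      ¬ ∃ B : Ideal (R ⧸ I), B = B ^ 2 ∧ B ≠ ⊤ ∧ IsEssentialSubmodule B)
    {J P : Ideal R} (hPJ : P ∈ J.minimalPrimes) :
    ∃ k, ∀ (m : Ideal R) [m.IsPrime], P ≤ m → P ^ k ≤ saturation m J := by
  have hP : P.IsPrime := hPJ.1.1
  obtain ⟨k, hk⟩ := hR.exists_pow_le_saturation hid hPJ
  refine ⟨k + 1, fun m hm hPm => ?_⟩
  rw [pow_succ', Ideal.mul_le]
  intro a ha b hb
  obtain ⟨s, hs, hsb⟩ := hk hb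
  obtain ⟨u, hu, h⟩ | ⟨u, hu, h⟩ := hR m a s
  · obtain ⟨r, hr⟩ := Ideal.mem_span_singleton'.1 h
    refine ⟨u, hu, ?_⟩
    rw [← mul_assoc, ← hr, mul_assoc]
    exact J.mul_mem_left _ hsb
  · have hus : u * s ∈ P := (Ideal.span_singleton_le_iff_mem _).2 ha h
    exact absurd ((hP.mem_or_mem hus).resolve_right hs) fun h => hu (hPm h)

/-- Every ideal contains a product of powers of its finitely many minimal primes. -/
theorem LocallyComparable.exists_prod_pow_le (hR : LocallyComparable R)
    (hfd : ∀ I : Ideal R, IsFiniteDimensionalModule (R ⧸ I) (R ⧸ I))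
    (hid : ∀ I : Ideal R,
      ¬ ∃ B : Ideal (R ⧸ I), B = B ^ 2 ∧ B ≠ ⊤ ∧ IsEssentialSubmodule B) (J : Ideal R) :
    ∃ (s : Finset (Ideal R)) (k : Ideal R → ℕ), (∀ P ∈ s, P ∈ J.minimalPrimes) ∧
      ∏ P ∈ s, P ^ k P ≤ J := by
  have hfin := finite_minimalPrimes_of_isFiniteDimensionalModule J (hfd _)
  choose! k hk using fun (P : Ideal R) (hP : P ∈ J.minimalPrimes) =>
    hR.exists_pow_le_saturation_of_le hid hP
  refine ⟨hfin.toFinset, k, fun P hP => hfin.mem_toFinset.1 hP, fun x hx =>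
    mem_of_forall_mem_saturation fun m hm => ?_⟩
  by_cases hJm : J ≤ m
  · obtain ⟨P, hP, hPm⟩ := Ideal.exists_minimalPrimes_le hJm
    exact hk P hP m hPm (Ideal.le_of_dvd
      (Finset.dvd_prod_of_mem (fun P => P ^ k P) (hfin.mem_toFinset.2 hP)) hx)
  · obtain ⟨j, hj, hjm⟩ := SetLike.not_le_iff_exists.1 hJm
    exact ⟨j, hjm, J.mul_mem_right _ hj⟩

theorem LocallyComparable.not_denseBetween (hR : LocallyComparable R)
    (hfd : ∀ I : Ideal R, IsFiniteDimensionalModule (R ⧸ I) (R ⧸ I))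
    (hid : ∀ I : Ideal R,
      ¬ ∃ B : Ideal (R ⧸ I), B = B ^ 2 ∧ B ≠ ⊤ ∧ IsEssentialSubmodule B) (X Y : Ideal R) :
    ¬ DenseBetween X Y := by
  have hwf := hR.wellFoundedGT_primeSpectrum hid
  have hreduce : ∀ J : Ideal R, (∀ P ∈ J.minimalPrimes, ¬ DenseBetween P ⊤) →
      ¬ DenseBetween J ⊤ := fun J hJ h => by
    obtain ⟨s, k, hs, hsk⟩ := hR.exists_prod_pow_le hfd hid J
    exact not_denseBetween_prod_pow_top hfd s k (fun P hP => hJ P (hs P hP)) (h.mono hsk le_top)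
  have hprime : ∀ P : PrimeSpectrum R, ¬ DenseBetween P.asIdeal ⊤ := by
    intro P
    induction P using WellFoundedGT.induction with
    | ind P ih =>
    intro h
    -- The upper half of a dense chain from `P` to `R` starts at an ideal strictly above `P`.
    obtain ⟨c, h₁, h₂⟩ := h.exists_between
    exact hreduce c (fun Q hQ => ih ⟨Q, hQ.1.1⟩ (h₁.lt.trans_le hQ.1.2)) h₂
  exact fun h => hreduce ⊥ (fun P hP => hprime ⟨P, hP.1.1⟩) (h.mono bot_le le_top)

end NoIdempotent

/-! ### The characterization -/

theorem theorem1 (A : Type u) [CommRing A] (hA : IsArithmeticalRing A) :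
    HasKrullDim A A ↔
      ∀ I : Ideal A,
        IsFiniteDimensionalModule (A ⧸ I) (A ⧸ I) ∧
        ¬ ∃ B : Ideal (A ⧸ I), B = B ^ 2 ∧ B ≠ ⊤ ∧ IsEssentialSubmodule B := by
  have hloc := hA.locallyComparable
  rw [hasKrullDim_iff]
  refine ⟨fun h I => ?_, fun h => hloc.not_denseBetween (fun I => (h I).1) (fun I => (h I).2)⟩
  -- Dense chains of ideals of a factor ring of `A` pull back to `A`.
  have hquot : ∀ X Y : Ideal (A ⧸ I), ¬ DenseBetween X Y := fun X Y hXY =>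
    h _ _ (hXY.map (φ := Ideal.comap (Ideal.Quotient.mk I)) fun _ _ _ _ hxy =>
      (Ideal.orderEmbeddingOfSurjective (Ideal.Quotient.mk I)
        Ideal.Quotient.mk_surjective).strictMono hxy.lt)
  refine ⟨fun ⟨f, hf, hind⟩ => ?_, fun ⟨B, hB, hB', hess⟩ => hB' ?_⟩
  · obtain ⟨X, Y, hXY⟩ := exists_denseBetween_of_iSupIndep hf hind
    exact hquot X Y hXY
  · have hB2 : B ≤ B * B := by rw [← pow_two, ← hB]
    refine eq_top_of_pure_of_isEssentialSubmodule (fun ⟨f, hf, hind⟩ => ?_)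
      (fun b hb => exists_mul_eq_self_of_idempotent (hloc.quotient I) hquot hB2 hb) hess
    obtain ⟨X, Y, hXY⟩ := exists_denseBetween_of_iSupIndep hf hind
    exact hquot _ _ (hXY.map (φ := Ideal.comap (Ideal.Quotient.mk (⊥ : Ideal (A ⧸ I))))
      fun _ _ _ _ hxy => (Ideal.orderEmbeddingOfSurjective (Ideal.Quotient.mk ⊥)
        Ideal.Quotient.mk_surjective).strictMono hxy.lt)
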